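/- Let $n,m\ge 0$ be integers, $T>0$, $A_i\in\mathbb R^{n\times n}$, $B_i\in\mathbb R^{n\times 1}$, $C_i\in\mathbb R^{1\times n}$, $D_i\in\mathbb R$ for $1\le i\le m$, and let $\operatorname{sgn}$ be the multivalued sign function: $\operatorname{sgn}(r)=\{-1\}$ for $r<0$, $\{1\}$ for $r>0$, and $\operatorname{sgn}(0)=[-1,1]$. Let $f:[0,T]\times\mathbb R^n\to\mathbb R^n$ satisfy: (a) there is $L\ge 0$ such that $\|f(t,x_1)-f(t,x_2)\|\le L\|x_1-x_2\|$ for all $t\in[0,T]$ and $x_1,x_2\in\mathbb R^n$; (b) $f$ has a time derivative $\partial f/\partial t$ on $(0,T)$ (that is, for every $x$ the function $f(\cdot,x)$ agrees a.e. on $(0,T)$ with a primitive of the integrable function $\frac{\partial f}{\partial t}(\cdot,x)$), and for every $R\ge 0$ $$\sup\Big\{\big\|\tfrac{\partial f}{\partial t}(\cdot,v(\cdot))\big\|_{L^2((0,T);\mathbb R^n)} \;:\; v\in L^2((0,T);\mathbb R^n),\ \|v\|_{L^2((0,T);\mathbb R^n)}\le R\Big\}<\infty .$$ Suppose that for each $i$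 one has $B_i=\alpha C_i^{T}$ for some $\alpha>0$ (which may be the same for all $i$ or depend on $i$), $D_i=0$, and $\operatorname{Ker}(C_i)\subseteq\operatorname{Ker}(A_i)$. Then for every $x_0\in\mathbb R^n$ the differential inclusion $$\dot x(t)\in f(t,x(t))-\sum_{i=1}^m\big(A_i x(t)+B_i\big)\operatorname{sgn}\big(C_i x(t)+D_i\big)\quad\text{for a.e. } t\in(0,T),\qquad x(0)=x_0,$$ has a solution that is Lipschitz continuous on $[0,T]$, and this solution is unique among all absolutely continuous functions on $[0,T]$ that satisfy the inclusion a.e. on $(0,T)$ and the initial condition. -/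

import Mathlib

open MeasureTheory Set

/-- The multivalued sign function: `{-1}` on negative reals, `{1}` on positive reals and the whole
interval `[-1, 1]` at `0`. -/
def multiSgn (r : ℝ) : Set ℝ :=
  {s | (r < 0 → s = -1) ∧ (0 < r → s = 1) ∧ (r = 0 → s ∈ Icc (-1 : ℝ) 1)}

/-- The action of a real `p × q` matrix on a column vector. -/
noncomputable def matAct {p q : ℕ} (M : Matrix (Fin p) (Fin q) ℝ)
    (x : EuclideanSpace ℝ (Fin q)) : EuclideanSpace ℝ (Fin p) :=
  WithLp.toLp 2 (M.mulVec x.ofLp)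

/-- An `n × 1` matrix seen as a vector. -/
noncomputable def colVec {n : ℕ} (B : Matrix (Fin n) (Fin 1) ℝ) : EuclideanSpace ℝ (Fin n) :=
  WithLp.toLp 2 (fun j => B j 0)

/-- The kernel of a matrix. -/
def matKer {p q : ℕ} (M : Matrix (Fin p) (Fin q) ℝ) : Set (EuclideanSpace ℝ (Fin q)) :=
  {x | matAct M x = 0}

/-- The multivalued right-hand side `f(t,x) - ∑ i, (A i x + B i) sgn (C i x + D i)`, the sum being
the Minkowski sum of the sets `{s • (A i x + B i) | s ∈ sgn (C i x + D i)}`. -/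
def inclusionRHS {n m : ℕ}
    (f : ℝ → EuclideanSpace ℝ (Fin n) → EuclideanSpace ℝ (Fin n))
    (A : Fin m → Matrix (Fin n) (Fin n) ℝ) (B : Fin m → Matrix (Fin n) (Fin 1) ℝ)
    (C : Fin m → Matrix (Fin 1) (Fin n) ℝ) (D : Fin m → ℝ)
    (t : ℝ) (x : EuclideanSpace ℝ (Fin n)) : Set (EuclideanSpace ℝ (Fin n)) :=
  {y | ∃ s : Fin m → ℝ, (∀ i, s i ∈ multiSgn (matAct (C i) x 0 + D i)) ∧
    y = f t x - ∑ i, s i • (matAct (A i) x + colVec (B i))}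

/-- `x` is a (Carathéodory) solution on `[0, T]` of `ẋ(t) ∈ F(t, x(t))` for a.e. `t ∈ (0, T)`,
`x(0) = x₀`: it is absolutely continuous and satisfies the inclusion almost everywhere. -/
structure IsSolution {E : Type*} [NormedAddCommGroup E] [NormedSpace ℝ E]
    (T : ℝ) (F : ℝ → E → Set E) (x₀ : E) (x : ℝ → E) : Prop where
  absCont : AbsolutelyContinuousOnInterval x 0 T
  initial : x 0 = x₀
  inclusion : ∀ᵐ t ∂(volume.restrict (Ioo 0 T)), ∃ x' ∈ F t (x t), HasDerivAt x x' t

/-- `f(t, ·)` is Lipschitz on the whole space, uniformly in `t ∈ [0, T]`. -/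
def UniformlyLipschitzInState {E : Type*} [NormedAddCommGroup E] (T : ℝ) (f : ℝ → E → E) : Prop :=
  ∃ L : ℝ, 0 ≤ L ∧ ∀ t ∈ Icc 0 T, ∀ x₁ x₂ : E, ‖f t x₁ - f t x₂‖ ≤ L * ‖x₁ - x₂‖

/-- `g` is the partial derivative `∂f/∂t` on `(0, T)` in the Sobolev sense: for every fixed `x`,
`g(·, x)` is integrable and `f(·, x)` agrees a.e. on `(0, T)` with a primitive of `g(·, x)`. -/
def IsTimeDerivative {E : Type*} [NormedAddCommGroup E] [NormedSpace ℝ E]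
    (T : ℝ) (f g : ℝ → E → E) : Prop :=
  ∀ x : E, IntegrableOn (fun t => g t x) (Ioo 0 T) ∧
    ∃ c : E, ∀ᵐ t ∂(volume.restrict (Ioo 0 T)), f t x = c + ∫ r in (0 : ℝ)..t, g r x

/-- The time derivative `∂f/∂t` exists and, for every `R ≥ 0`, the supremum `Φ(R)` of the norms
`‖∂f/∂t(·, v(·))‖` in `L²((0,T))`, over all `v` with `‖v‖ ≤ R` in `L²((0,T))`, is finite. -/
def TimeDerivativeL2Bounded {E : Type*} [NormedAddCommGroup E] [NormedSpace ℝ E]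
    (T : ℝ) (f : ℝ → E → E) : Prop :=
  ∃ g : ℝ → E → E, IsTimeDerivative T f g ∧
    ∃ Φ : ℝ → ℝ, ∀ R : ℝ, 0 ≤ R → ∀ v : ℝ → E,
      MemLp v 2 (volume.restrict (Ioo 0 T)) →
      eLpNorm v 2 (volume.restrict (Ioo 0 T)) ≤ ENNReal.ofReal R →
        MemLp (fun t => g t (v t)) 2 (volume.restrict (Ioo 0 T)) ∧
        eLpNorm (fun t => g t (v t)) 2 (volume.restrict (Ioo 0 T)) ≤ ENNReal.ofReal (Φ R)

/-! Write `c i` for the transposed row `C i`. A matrix vanishing on the kernel of that row has the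
form `x ↦ ⟨c i, x⟩ • a i`, and `s * u = |u|` for every `s ∈ multiSgn u`. So the terms `A i x`
contribute the single-valued Lipschitz field `|⟨c i, x⟩| • a i`, which is absorbed into `f`. What
remains multivalued is `α i • sgn ⟨c i, x⟩ • c i`, the subdifferential of the convex function `α i *
|⟨c i, x⟩|`, hence monotone.

Uniqueness: monotonicity gives `‖x - y‖²` a derivative at most `2L‖x - y‖²`, and Grönwall concludes.

Existence: the sign is replaced by a ramp of slope `1/ε`. The ramp is monotone relative to the sign,
and to other ramps, up to an error linear in the widths, so `norm_sub_sq_le_of_isApproxSign` also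
makes the regularised solutions uniformly Cauchy. Their speeds are bounded independently of `ε`, so
the limit is Lipschitz. It satisfies the inclusion because the admissible velocities form a compact
convex set, which retains averages and limits (`exists_sign_of_tendstoUniformlyOn`).

Since `f` is only a.e. a primitive in time, it is first replaced by a version continuous in time,
off a null set common to all states (`IsTimeDerivative.exists_continuous_version`). -/

/-! ### Absolutely continuous functions and Grönwall's inequality -/

theorem AbsolutelyContinuousOnInterval.norm {E : Type*} [NormedAddCommGroup E] {f : ℝ → E}
    {a b : ℝ} (hf : AbsolutelyContinuousOnInterval f a b) :
    AbsolutelyContinuousOnInterval (fun t => ‖f t‖) a b := by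
  refine squeeze_zero (fun t => Finset.sum_nonneg fun i _ => dist_nonneg) (fun t => ?_) hf
  gcongr
  rw [dist_eq_norm, dist_eq_norm, Real.norm_eq_abs]
  exact abs_norm_sub_norm_le _ _

theorem AbsolutelyContinuousOnInterval.le_left_of_deriv_nonpos {u : ℝ → ℝ} {a b : ℝ}
    (hu : AbsolutelyContinuousOnInterval u a b)
    (h : ∀ᵐ t ∂(volume.restrict (Ioo a b)), deriv u t ≤ 0) {t : ℝ} (ht : t ∈ Icc a b) :
    u t ≤ u a := by
  have hsub : uIcc a t ⊆ uIcc a b := by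
    rw [uIcc_of_le ht.1, uIcc_of_le (ht.1.trans ht.2)]
    exact Icc_subset_Icc_right ht.2
  have hint := (hu.mono hsub).integral_deriv_eq_sub
  have hle : ∫ s in a..t, deriv u s ≤ 0 := by
    rw [intervalIntegral.integral_of_le ht.1, ← setIntegral_congr_set Ioo_ae_eq_Ioc]
    exact integral_nonpos_of_ae
      (ae_restrict_of_ae_restrict_of_subset (Ioo_subset_Ioo_right ht.2) h)
  linarith

/-- Grönwall's inequality for absolutely continuous functions. -/
theorem AbsolutelyContinuousOnInterval.le_of_ae_deriv_le {h : ℝ → ℝ} {T K ε : ℝ}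
    (hh : AbsolutelyContinuousOnInterval h 0 T) (hK : 0 ≤ K) (hε : 0 ≤ ε) (h0 : h 0 ≤ 0)
    (hd : ∀ᵐ t ∂(volume.restrict (Ioo 0 T)), ∃ h', HasDerivAt h h' t ∧ h' ≤ K * h t + ε)
    {t : ℝ} (ht : t ∈ Icc 0 T) : h t ≤ ε * t * Real.exp (K * t) := by
  have hT : 0 ≤ T := ht.1.trans ht.2
  have hexp : AbsolutelyContinuousOnInterval (fun t => Real.exp (-K * t)) 0 T :=
    ContDiffOn.absolutelyContinuousOnInterval (ContDiff.contDiffOn (by fun_prop))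
  have hid : AbsolutelyContinuousOnInterval (fun t => ε * t) 0 T :=
    ContDiffOn.absolutelyContinuousOnInterval (ContDiff.contDiffOn (by fun_prop))
  -- The function `exp (-K t) * h t - ε t` is nonincreasing: the forcing `ε exp (-K t)` is at most
  -- `ε` because `K t ≥ 0`.
  have key := ((hexp.fun_mul hh).fun_sub hid).le_left_of_deriv_nonpos (t := t) ?_ ht
  · simp only [mul_zero, Real.exp_zero, one_mul, sub_zero] at key
    have h1 : Real.exp (-K * t) * h t ≤ ε * t := by linarith
    have h2 : Real.exp (K * t) * Real.exp (-K * t) = 1 := by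
      rw [← Real.exp_add]; simp
    calc h t = Real.exp (K * t) * (Real.exp (-K * t) * h t) := by rw [← mul_assoc, h2, one_mul]
      _ ≤ Real.exp (K * t) * (ε * t) := by gcongr
      _ = _ := by ring
  · filter_upwards [hd, self_mem_ae_restrict measurableSet_Ioo] with s ⟨h', hh', hle⟩ hs
    have he : HasDerivAt (fun t => Real.exp (-K * t)) (Real.exp (-K * s) * (-K * 1)) s :=
      ((hasDerivAt_id s).const_mul (-K)).exp
    have hD := (he.mul hh').sub ((hasDerivAt_id s).const_mul ε)
    have hD' := hD.deriv
    have e1 : Real.exp (-K * s) ≤ 1 := by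
      rw [Real.exp_le_one_iff]; nlinarith [hs.1]
    have e2 := Real.exp_pos (-K * s)
    refine (le_of_eq hD').trans ?_
    nlinarith [mul_le_mul_of_nonneg_left hle e2.le]

/-! ### Approximate signs and comparison of solutions -/

/-- The scalar `s` is a sign of `u` up to an error `ε`: for `ε = 0` this says `s ∈ multiSgn u`. -/
structure IsApproxSign (ε u s : ℝ) : Prop where
  abs_le : |s| ≤ 1
  le_mul : |u| - 2 * ε ≤ u * s

theorem isApproxSign_of_mem_multiSgn {u s : ℝ} (h : s ∈ multiSgn u) : IsApproxSign 0 u s := by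
  obtain ⟨h1, h2, h3⟩ := h
  rcases lt_trichotomy u 0 with hu | hu | hu
  · rw [h1 hu]; exact ⟨by simp, by simp [abs_of_neg hu]⟩
  · exact ⟨abs_le.2 (h3 hu), by simp [hu]⟩
  · rw [h2 hu]; exact ⟨by simp, by simp [abs_of_pos hu]⟩

/-- Monotonicity of the sign up to an error: in the expanded product, `u * s` and `v * r` nearly
reach `|u|` and `|v|`, which the cross terms cannot exceed. -/
theorem IsApproxSign.sub_mul_sub_ge {ε δ u v s r : ℝ} (hs : IsApproxSign ε u s)
    (hr : IsApproxSign δ v r) : -(2 * (ε + δ)) ≤ (u - v) * (s - r) := by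
  have h1 : u * r ≤ |u| := (le_abs_self _).trans (by
    rw [abs_mul]; exact mul_le_of_le_one_right (abs_nonneg _) hr.abs_le)
  have h2 : v * s ≤ |v| := (le_abs_self _).trans (by
    rw [abs_mul]; exact mul_le_of_le_one_right (abs_nonneg _) hs.abs_le)
  nlinarith [hs.le_mul, hr.le_mul]

section Comparison

variable {E : Type*} [NormedAddCommGroup E] [InnerProductSpace ℝ E] {ι : Type*} [Fintype ι]

/-- The right-hand side `F(t,x) - ∑ i, α i • s i • c i` for a choice `s` of the signs. -/
def signedField (F : ℝ → E → E) (α : ι → ℝ) (c : ι → E) (t : ℝ) (x : E) (s : ι → ℝ) : E :=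
  F t x - ∑ i, (α i * s i) • c i

/-- Two approximate solutions with the same initial value are close to each other. -/
theorem norm_sub_sq_le_of_isApproxSign {F : ℝ → E → E} {α : ι → ℝ} {c : ι → E} {T L ε δ : ℝ}
    (hα : ∀ i, 0 ≤ α i) (hL : 0 ≤ L) (hε : 0 ≤ ε) (hδ : 0 ≤ δ)
    (hF : ∀ t ∈ Icc 0 T, ∀ x₁ x₂ : E, ‖F t x₁ - F t x₂‖ ≤ L * ‖x₁ - x₂‖) {x y : ℝ → E}
    (hx : AbsolutelyContinuousOnInterval x 0 T) (hy : AbsolutelyContinuousOnInterval y 0 T)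
    (h0 : x 0 = y 0)
    (hx' : ∀ᵐ t ∂(volume.restrict (Ioo 0 T)), ∃ s : ι → ℝ,
      (∀ i, IsApproxSign ε (inner ℝ (c i) (x t)) (s i)) ∧
        HasDerivAt x (signedField F α c t (x t) s) t)
    (hy' : ∀ᵐ t ∂(volume.restrict (Ioo 0 T)), ∃ s : ι → ℝ,
      (∀ i, IsApproxSign δ (inner ℝ (c i) (y t)) (s i)) ∧
        HasDerivAt y (signedField F α c t (y t) s) t)
    {t : ℝ} (ht : t ∈ Icc 0 T) :
    ‖x t - y t‖ ^ 2 ≤ (∑ i, α i) * (4 * (ε + δ)) * t * Real.exp (2 * L * t) := by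
  have hac := (hx.fun_sub hy).norm
  have hac2 : AbsolutelyContinuousOnInterval (fun t => ‖x t - y t‖ ^ 2) 0 T := by
    simpa only [pow_two] using hac.fun_mul hac
  -- Differentiating the square doubles both the Lipschitz constant `L` and the monotonicity defect
  -- `2 * (ε + δ)`.
  refine hac2.le_of_ae_deriv_le (by positivity)
    (mul_nonneg (Finset.sum_nonneg fun i _ => hα i) (by positivity)) (by simp [h0]) ?_ ht
  filter_upwards [hx', hy', self_mem_ae_restrict measurableSet_Ioo]
    with r ⟨s, hs, hxs⟩ ⟨q, hq, hyq⟩ hr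
  refine ⟨_, (hxs.sub hyq).norm_sq, ?_⟩
  have hdiff : signedField F α c r (x r) s - signedField F α c r (y r) q
      = (F r (x r) - F r (y r)) - ∑ i, (α i * (s i - q i)) • c i := by
    simp only [signedField, mul_sub, sub_smul, Finset.sum_sub_distrib]
    abel
  have h1 : inner ℝ (x r - y r) (F r (x r) - F r (y r)) ≤ L * ‖x r - y r‖ ^ 2 := by
    refine (real_inner_le_norm _ _).trans ?_
    have := hF r (Ioo_subset_Icc_self hr) (x r) (y r)
    nlinarith [norm_nonneg (x r - y r)]
  have h2 : -((∑ i, α i) * (2 * (ε + δ)))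
      ≤ inner ℝ (x r - y r) (∑ i, (α i * (s i - q i)) • c i) := by
    rw [inner_sum, Finset.sum_mul, ← Finset.sum_neg_distrib]
    refine Finset.sum_le_sum fun i _ => ?_
    have h3 := (hs i).sub_mul_sub_ge (hq i)
    rw [inner_smul_right, real_inner_comm, inner_sub_right]
    nlinarith [mul_le_mul_of_nonneg_left h3 (hα i)]
  simp only [Pi.sub_apply]
  rw [hdiff, inner_sub_right]
  linarith

end Comparison

/-! ### Global solutions of Lipschitz equations -/

section GlobalODE

variable {E : Type*} [NormedAddCommGroup E] [NormedSpace ℝ E]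

/-- The radial retraction onto the closed ball of radius `M`. -/
noncomputable def radialRetraction (M : ℝ) (v : E) : E := (M / max M ‖v‖) • v

theorem radialRetraction_of_norm_le {M : ℝ} (hM : 0 < M) {v : E} (hv : ‖v‖ ≤ M) :
    radialRetraction M v = v := by
  rw [radialRetraction, max_eq_left hv, div_self hM.ne', one_smul]

theorem norm_radialRetraction_le {M : ℝ} (hM : 0 < M) (v : E) :
    ‖radialRetraction M v‖ ≤ M := by
  have h : 0 < max M ‖v‖ := lt_max_of_lt_left hM
  rw [radialRetraction, norm_smul, Real.norm_of_nonneg (by positivity), div_mul_eq_mul_div,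
    div_le_iff₀ h]
  gcongr
  exact le_max_right _ _

theorem norm_radialRetraction_le_norm {M : ℝ} (hM : 0 < M) (v : E) :
    ‖radialRetraction M v‖ ≤ ‖v‖ := by
  have h : 0 < max M ‖v‖ := lt_max_of_lt_left hM
  rw [radialRetraction, norm_smul, Real.norm_of_nonneg (by positivity)]
  exact mul_le_of_le_one_left (norm_nonneg _) ((div_le_one h).2 (le_max_left _ _))

theorem lipschitzWith_radialRetraction {M : ℝ} (hM : 0 < M) :
    LipschitzWith 2 (radialRetraction M : E → E) := by
  refine LipschitzWith.of_dist_le_mul fun v w => ?_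
  rw [dist_eq_norm, dist_eq_norm]
  set a := max M ‖v‖ with ha
  set b := max M ‖w‖ with hb
  have ha0 : 0 < a := lt_max_of_lt_left hM
  have hb0 : 0 < b := lt_max_of_lt_left hM
  have hab : |b - a| ≤ ‖v - w‖ := by
    rw [hb, ha, max_comm M, max_comm M]
    refine (abs_max_sub_max_le_abs _ _ _).trans ?_
    rw [abs_sub_comm]
    exact abs_norm_sub_norm_le _ _
  -- Each of the two summands is at most `‖v - w‖`, whence the constant 2.
  have hsplit : radialRetraction M v - radialRetraction M w
      = (M / a) • (v - w) + (M / a - M / b) • w := by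
    simp only [radialRetraction, ← ha, ← hb]; module
  have h1 : ‖(M / a) • (v - w)‖ ≤ ‖v - w‖ := by
    rw [norm_smul, Real.norm_of_nonneg (by positivity)]
    exact mul_le_of_le_one_left (norm_nonneg _) ((div_le_one ha0).2 (le_max_left _ _))
  have h2 : ‖(M / a - M / b) • w‖ ≤ ‖v - w‖ := by
    have : M / a - M / b = (M / a) * ((b - a) / b) := by field_simp
    rw [norm_smul, this, norm_mul, norm_div, norm_div, Real.norm_of_nonneg hM.le,
      Real.norm_of_nonneg ha0.le, Real.norm_of_nonneg hb0.le, Real.norm_eq_abs]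
    have e1 : M / a ≤ 1 := (div_le_one ha0).2 (le_max_left _ _)
    have e2 : ‖w‖ / b ≤ 1 := (div_le_one hb0).2 (le_max_right _ _)
    calc M / a * (|b - a| / b) * ‖w‖ = (M / a) * (‖w‖ / b) * |b - a| := by ring
      _ ≤ 1 * 1 * ‖v - w‖ := by gcongr
      _ = ‖v - w‖ := by ring
  rw [hsplit]
  refine (norm_add_le _ _).trans ?_
  rw [NNReal.coe_ofNat]
  linarith

variable [CompleteSpace E]

/-- Global existence for a Lipschitz field on a compact time interval, with a bound of the speed
that depends only on the growth of the field. -/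
theorem exists_hasDerivWithinAt_of_lipschitzWith {V : ℝ → E → E} {T M L : ℝ} {K : NNReal} {x₀ : E}
    (hT : 0 ≤ T) (hM : 0 ≤ M) (hL : 0 ≤ L)
    (hlip : ∀ t ∈ Icc 0 T, LipschitzWith K (V t))
    (hcont : ∀ x, ContinuousOn (fun t => V t x) (Icc 0 T))
    (hgrowth : ∀ t ∈ Icc 0 T, ∀ x, ‖V t x‖ ≤ L * ‖x - x₀‖ + M) :
    ∃ x : ℝ → E, x 0 = x₀ ∧ (∀ t ∈ Icc 0 T, HasDerivWithinAt x (V t (x t)) (Icc 0 T) t) ∧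
      ∀ t ∈ Icc 0 T, ‖V t (x t)‖ ≤ L * gronwallBound 0 L M T + M := by
  have hmono := gronwallBound_mono (le_refl (0 : ℝ)) hM hL
  have hρ : 0 ≤ gronwallBound 0 L M T := by
    have := hmono hT
    rwa [gronwallBound_x0] at this
  set S := L * gronwallBound 0 L M T + M + 1 with hS
  have hS0 : 0 < S := by positivity
  -- With speed capped at `S`, a solution cannot leave the ball of radius `S * T` before time `T`,
  -- so Picard–Lindelöf covers the whole interval. Grönwall then shows that the cap is never active;
  -- the `+ 1` in `S` only ensures positivity.
  let W : ℝ → E → E := fun t x => radialRetraction S (V t x)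
  let S' : NNReal := ⟨S, hS0.le⟩
  let T' : NNReal := ⟨T, hT⟩
  have hPL : IsPicardLindelof W (⟨0, left_mem_Icc.2 hT⟩ : Icc (0 : ℝ) T) x₀ (S' * T') 0 S'
      (2 * K) := by
    refine ⟨fun t ht => ((lipschitzWith_radialRetraction hS0).comp (hlip t ht)).lipschitzOnWith,
      fun x _ => (lipschitzWith_radialRetraction hS0).continuous.comp_continuousOn (hcont x),
      fun t _ x _ => norm_radialRetraction_le hS0 _, ?_⟩
    simp only [sub_zero, max_eq_left hT, NNReal.coe_zero]
    exact le_rfl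
  obtain ⟨x, hx0, hx⟩ := hPL.exists_eq_forall_mem_Icc_hasDerivWithinAt₀
  have hx0 : x 0 = x₀ := hx0
  have hbound : ∀ t ∈ Icc 0 T, ‖x t - x₀‖ ≤ gronwallBound 0 L M (t - 0) := by
    refine norm_le_gronwallBound_of_norm_deriv_right_le (f := fun t => x t - x₀)
      (f' := fun t => W t (x t))
      ((fun t ht => (hx t ht).continuousWithinAt.sub continuousWithinAt_const)) ?_
      (by simp [hx0]) ?_
    · intro t ht
      exact ((hx t (Ico_subset_Icc_self ht)).mono_of_mem_nhdsWithin
        (Icc_mem_nhdsGE_of_mem ht)).sub_const _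
    · intro t ht
      exact (norm_radialRetraction_le_norm hS0 _).trans (hgrowth t (Ico_subset_Icc_self ht) _)
  have hspeed : ∀ t ∈ Icc 0 T, ‖V t (x t)‖ ≤ L * gronwallBound 0 L M T + M := by
    intro t ht
    refine (hgrowth t ht _).trans ?_
    gcongr
    refine (hbound t ht).trans (hmono ?_)
    simpa using ht.2
  refine ⟨x, hx0, fun t ht => ?_, hspeed⟩
  have := hx t ht
  rwa [show W t (x t) = V t (x t) from
    radialRetraction_of_norm_le hS0 (by linarith [hspeed t ht])] at this

end GlobalODE

theorem continuousOn_uncurry_of_norm_sub_le {E : Type*} [NormedAddCommGroup E]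
    {F : ℝ → E → E} {T L : ℝ} (hL : 0 ≤ L)
    (hF : ∀ t ∈ Icc 0 T, ∀ x₁ x₂ : E, ‖F t x₁ - F t x₂‖ ≤ L * ‖x₁ - x₂‖)
    (hc : ∀ x, ContinuousOn (fun t => F t x) (Icc 0 T)) :
    ContinuousOn (Function.uncurry F) (Icc 0 T ×ˢ univ) :=
  continuousOn_prod_of_continuousOn_lipschitzOnWith' _ ⟨L, hL⟩
    (fun t ht => LipschitzOnWith.of_dist_le_mul fun x _ y _ => by
      rw [dist_eq_norm, dist_eq_norm]; exact hF t ht x y)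
    (fun x _ => hc x)

/-! ### Ramp approximation of the sign -/

section Clamp

/-- The piecewise linear approximation of the sign function with slope `1 / ε` at `0`. -/
noncomputable def clampSign (ε r : ℝ) : ℝ := max (-1) (min 1 (r / ε))

theorem abs_clampSign_le (ε r : ℝ) : |clampSign ε r| ≤ 1 :=
  abs_le.2 ⟨le_max_left _ _, max_le (by norm_num) (min_le_left _ _)⟩

theorem clampSign_of_le {ε r : ℝ} (hε : 0 < ε) (h : ε ≤ r) : clampSign ε r = 1 := by
  have : 1 ≤ r / ε := (one_le_div hε).2 h
  rw [clampSign, min_eq_left this]; norm_num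

theorem clampSign_of_le_neg {ε r : ℝ} (hε : 0 < ε) (h : r ≤ -ε) : clampSign ε r = -1 := by
  have : r / ε ≤ -1 := (div_le_iff₀ hε).2 (by linarith)
  rw [clampSign, max_eq_left ((min_le_right _ _).trans this)]

theorem isApproxSign_clampSign {ε : ℝ} (hε : 0 < ε) (u : ℝ) :
    IsApproxSign ε u (clampSign ε u) := by
  refine ⟨abs_clampSign_le ε u, ?_⟩
  rcases le_or_gt ε u with h | h
  · rw [clampSign_of_le hε h, abs_of_pos (hε.trans_le h)]; linarith
  rcases le_or_gt u (-ε) with h' | h'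
  · rw [clampSign_of_le_neg hε h', abs_of_neg (by linarith)]; linarith
  -- Inside the ramp only `u * clampSign ε u ≥ -|u|` is used, and `|u| - 2 * ε ≤ -|u|` is the same
  -- as `|u| ≤ ε`; hence the factor 2 in `IsApproxSign`.
  have h1 : |u| ≤ ε := abs_le.2 ⟨h'.le, h.le⟩
  have h2 : |u * clampSign ε u| ≤ |u| := by
    rw [abs_mul]; exact mul_le_of_le_one_right (abs_nonneg _) (abs_clampSign_le ε u)
  linarith [neg_abs_le (u * clampSign ε u)]

theorem abs_clampSign_sub_le {ε : ℝ} (hε : 0 < ε) (u v : ℝ) :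
    |clampSign ε u - clampSign ε v| ≤ |u - v| / ε := by
  rw [clampSign, clampSign, max_comm (-1), max_comm (-1), min_comm 1, min_comm 1]
  refine (abs_max_sub_max_le_abs _ _ _).trans ?_
  have h := abs_min_sub_min_le_max (u / ε) 1 (v / ε) 1
  rw [sub_self, abs_zero, max_eq_left (abs_nonneg _), ← sub_div, abs_div, abs_of_pos hε] at h
  exact h

/-- Makes the set of admissible sign vectors an order box, hence compact and convex. -/
theorem multiSgn_eq_Icc (u : ℝ) :
    multiSgn u = Icc (if 0 < u then 1 else -1) (if u < 0 then -1 else 1) := by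
  ext s
  rcases lt_trichotomy u 0 with hu | hu | hu
  · simp [multiSgn, hu, hu.not_gt, hu.ne, le_antisymm_iff, and_comm]
  · simp [multiSgn, hu]
  · simp [multiSgn, hu, hu.not_gt, hu.ne', le_antisymm_iff, and_comm]

end Clamp

/-! ### Existence by regularisation and passage to the limit -/

section Existence

open Filter Topology

variable {E : Type*} [NormedAddCommGroup E] [InnerProductSpace ℝ E] {ι : Type*} [Fintype ι]
  {F : ℝ → E → E} {α : ι → ℝ} {c : ι → E} {T L : ℝ}

theorem norm_sum_smul_le (hα : ∀ i, 0 ≤ α i) {s : ι → ℝ} {d : ℝ} (hs : ∀ i, |s i| ≤ d) :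
    ‖∑ i, (α i * s i) • c i‖ ≤ (∑ i, α i * ‖c i‖) * d := by
  rw [Finset.sum_mul]
  refine norm_sum_le_of_le _ fun i _ => ?_
  rw [norm_smul, norm_mul, Real.norm_of_nonneg (hα i), Real.norm_eq_abs]
  calc α i * |s i| * ‖c i‖ = α i * ‖c i‖ * |s i| := by ring
    _ ≤ α i * ‖c i‖ * d :=
      mul_le_mul_of_nonneg_left (hs i) (mul_nonneg (hα i) (norm_nonneg _))

/-- The field in which the sign function is replaced by `clampSign ε`. -/
noncomputable def clampField (F : ℝ → E → E) (α : ι → ℝ) (c : ι → E) (ε t : ℝ) (x : E) : E :=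
  signedField F α c t x fun i => clampSign ε (inner ℝ (c i) x)

theorem norm_clampField_sub_le (hα : ∀ i, 0 ≤ α i)
    (hF : ∀ t ∈ Icc 0 T, ∀ x₁ x₂ : E, ‖F t x₁ - F t x₂‖ ≤ L * ‖x₁ - x₂‖) {ε : ℝ} (hε : 0 < ε)
    {t : ℝ} (ht : t ∈ Icc 0 T) (x y : E) :
    ‖clampField F α c ε t x - clampField F α c ε t y‖
      ≤ (L + (∑ i, α i * ‖c i‖) * ((∑ i, ‖c i‖) / ε)) * ‖x - y‖ := by
  have hdiff : clampField F α c ε t x - clampField F α c ε t y = (F t x - F t y) -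
      ∑ i, (α i * (clampSign ε (inner ℝ (c i) x) - clampSign ε (inner ℝ (c i) y))) • c i := by
    simp only [clampField, signedField, mul_sub, sub_smul, Finset.sum_sub_distrib]
    abel
  rw [hdiff, add_mul]
  refine (norm_sub_le _ _).trans (add_le_add (hF t ht x y) ?_)
  rw [mul_assoc]
  refine norm_sum_smul_le hα fun i => (abs_clampSign_sub_le hε _ _).trans ?_
  rw [div_mul_eq_mul_div]
  gcongr
  rw [← inner_sub_right]
  refine (abs_real_inner_le_norm _ _).trans ?_
  gcongr
  exact Finset.single_le_sum (f := fun i => ‖c i‖) (fun i _ => norm_nonneg _) (Finset.mem_univ i)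

theorem continuousOn_clampField (hc : ∀ x, ContinuousOn (fun t => F t x) (Icc 0 T)) (ε : ℝ)
    (x : E) : ContinuousOn (fun t => clampField F α c ε t x) (Icc 0 T) :=
  (hc x).sub continuousOn_const

/-- The regularised equations have solutions, with a common bound of their speeds. -/
theorem exists_solution_clampField [CompleteSpace E] (hT : 0 ≤ T) (hα : ∀ i, 0 ≤ α i)
    (hL : 0 ≤ L) (hF : ∀ t ∈ Icc 0 T, ∀ x₁ x₂ : E, ‖F t x₁ - F t x₂‖ ≤ L * ‖x₁ - x₂‖)
    (hc : ∀ x, ContinuousOn (fun t => F t x) (Icc 0 T)) (x₀ : E) :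
    ∃ S : NNReal, ∀ ε > 0, ∃ x : ℝ → E, x 0 = x₀ ∧
      (∀ t ∈ Icc 0 T, HasDerivWithinAt x (clampField F α c ε t (x t)) (Icc 0 T) t) ∧
      LipschitzOnWith S x (Icc 0 T) := by
  obtain ⟨M, hM⟩ := isCompact_Icc.exists_bound_of_continuousOn (hc x₀)
  have hM0 : 0 ≤ M := (norm_nonneg _).trans (hM 0 (left_mem_Icc.2 hT))
  set N := ∑ i, α i * ‖c i‖ with hN
  have hN0 : 0 ≤ N := Finset.sum_nonneg fun i _ => mul_nonneg (hα i) (norm_nonneg _)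
  -- `M` bounds `F` at `x₀` and `N` bounds the sign part. Neither depends on `ε`, whereas the
  -- Lipschitz constant of the field grows like `1/ε`.
  refine ⟨(L * gronwallBound 0 L (M + N) T + (M + N)).toNNReal, fun ε hε => ?_⟩
  have hK : 0 ≤ L + N * ((∑ i, ‖c i‖) / ε) := by positivity
  have hgrowth : ∀ t ∈ Icc 0 T, ∀ x,
      ‖clampField F α c ε t x‖ ≤ L * ‖x - x₀‖ + (M + N) := by
    intro t ht x
    have h1 : ‖F t x‖ ≤ L * ‖x - x₀‖ + M := by
      have := norm_add_le (F t x - F t x₀) (F t x₀)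
      rw [sub_add_cancel] at this
      linarith [hF t ht x x₀, hM t ht]
    have h2 := norm_sum_smul_le (c := c) hα (s := fun i => clampSign ε (inner ℝ (c i) x))
      (fun i => abs_clampSign_le _ _)
    refine (norm_sub_le _ _).trans ?_
    rw [mul_one] at h2
    linarith
  obtain ⟨x, hx0, hx, hS⟩ := exists_hasDerivWithinAt_of_lipschitzWith (V := clampField F α c ε)
    (K := ⟨_, hK⟩) (x₀ := x₀) hT (add_nonneg hM0 hN0) hL
    (fun t ht => LipschitzWith.of_dist_le_mul fun x y => by
      rw [dist_eq_norm, dist_eq_norm]; exact norm_clampField_sub_le hα hF hε ht x y)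
    (continuousOn_clampField hc ε) hgrowth
  refine ⟨x, hx0, hx, (convex_Icc 0 T).lipschitzOnWith_of_nnnorm_hasDerivWithin_le hx
    fun t ht => ?_⟩
  rw [← NNReal.coe_le_coe, coe_nnnorm]
  exact (hS t ht).trans (Real.le_coe_toNNReal _)

/-- A mean value theorem for vector-valued functions: the difference quotient is the average of the
derivative, and a closed convex set contains averages of its points. -/
theorem Convex.inv_smul_sub_mem_of_hasDerivWithinAt [CompleteSpace E] {Q : Set E}
    (hQ : Convex ℝ Q) (hQc : IsClosed Q) {f f' : ℝ → E} {a b : ℝ} (hab : a < b)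
    (hf : ∀ t ∈ Icc a b, HasDerivWithinAt f (f' t) (Icc a b) t) (hf' : ContinuousOn f' (Icc a b))
    (hmem : ∀ t ∈ Icc a b, f' t ∈ Q) : (b - a)⁻¹ • (f b - f a) ∈ Q := by
  have hint : ∫ t in a..b, f' t = f b - f a :=
    intervalIntegral.integral_eq_sub_of_hasDeriv_right_of_le hab.le
      (fun t ht => (hf t ht).continuousWithinAt)
      (fun t ht => (hf t (Ioo_subset_Icc_self ht)).mono_of_mem_nhdsWithin
        (mem_nhdsWithin_of_mem_nhds (Icc_mem_nhds ht.1 ht.2)))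
      (hf'.intervalIntegrable_of_Icc hab.le)
  rw [← hint, ← interval_average_eq, uIoc_of_le hab.le]
  refine hQ.set_average_mem hQc (by simp [hab]) (by simp) ?_
    ((hf'.integrableOn_Icc).mono_set Ioc_subset_Icc_self)
  filter_upwards [self_mem_ae_restrict measurableSet_Ioc] with t ht
  exact hmem t (Ioc_subset_Icc_self ht)

theorem convex_image_signedField (t : ℝ) (x : E) (lo hi : ι → ℝ) :
    Convex ℝ (signedField F α c t x '' Icc lo hi) := by
  rintro _ ⟨s, hs, rfl⟩ _ ⟨q, hq, rfl⟩ a b ha hb hab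
  refine ⟨a • s + b • q, convex_Icc lo hi hs hq ha hb hab, ?_⟩
  have hsum : ∑ i, (α i * (a • s + b • q) i) • c i
      = a • ∑ i, (α i * s i) • c i + b • ∑ i, (α i * q i) • c i := by
    rw [Finset.smul_sum, Finset.smul_sum, ← Finset.sum_add_distrib]
    refine Finset.sum_congr rfl fun i _ => ?_
    simp only [Pi.add_apply, Pi.smul_apply, smul_eq_mul]
    module
  have hF : F t x = a • F t x + b • F t x := by rw [← add_smul, hab, one_smul]
  simp only [signedField]
  rw [hsum, smul_sub, smul_sub]
  nth_rw 1 [hF]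
  abel

theorem isCompact_image_signedField (t : ℝ) (x : E) (lo hi : ι → ℝ) :
    IsCompact (signedField F α c t x '' Icc lo hi) := by
  refine isCompact_Icc.image ?_
  unfold signedField
  fun_prop

/-- Away from `u = 0` the values `v` eventually leave the ramp, where the clamp is exact; at `u = 0`
all of `[-1, 1]` is allowed. -/
theorem eventually_clampSign_mem_multiSgn {β : Type*} {l : Filter β} {ε v : β → ℝ} {u : ℝ}
    (hε : Tendsto ε l (𝓝 0)) (hpos : ∀ b, 0 < ε b) (hv : Tendsto v l (𝓝 u)) :
    ∀ᶠ b in l, clampSign (ε b) (v b) ∈ multiSgn u := by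
  rcases lt_trichotomy u 0 with hu | hu | hu
  · filter_upwards [(hv.add hε).eventually_lt_const (show u + 0 < 0 by simpa using hu)] with b hb
    have hb : v b + ε b < 0 := hb
    rw [clampSign_of_le_neg (hpos b) (by linarith)]
    exact ⟨fun _ => rfl, fun h => absurd h hu.not_gt, fun h => absurd h hu.ne⟩
  · exact Eventually.of_forall fun b => ⟨fun h => absurd hu h.ne, fun h => absurd hu h.ne',
      fun _ => abs_le.1 (abs_clampSign_le _ _)⟩
  · filter_upwards [(hv.sub hε).eventually_const_lt (show 0 < u - 0 by simpa using hu)] with b hb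
    have hb : 0 < v b - ε b := hb
    rw [clampSign_of_le (hpos b) (by linarith)]
    exact ⟨fun h => absurd h hu.not_gt, fun _ => rfl, fun h => absurd h hu.ne'⟩

/-- A uniform limit of solutions of the regularised equations satisfies the inclusion wherever it
is differentiable. -/
theorem exists_sign_of_tendstoUniformlyOn [CompleteSpace E] (hα : ∀ i, 0 ≤ α i) (hL : 0 ≤ L)
    (hF : ∀ t ∈ Icc 0 T, ∀ x₁ x₂ : E, ‖F t x₁ - F t x₂‖ ≤ L * ‖x₁ - x₂‖)
    (hc : ∀ x, ContinuousOn (fun t => F t x) (Icc 0 T)) {e : ℕ → ℝ} (he : Tendsto e atTop (𝓝 0))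
    (hpos : ∀ k, 0 < e k) {X : ℕ → ℝ → E} {x : ℝ → E}
    (hX : ∀ k, ∀ t ∈ Icc 0 T, HasDerivWithinAt (X k) (clampField F α c (e k) t (X k t))
      (Icc 0 T) t)
    (hlim : TendstoUniformlyOn X x atTop (Icc 0 T)) {t : ℝ} (ht : t ∈ Ioo 0 T) {d : E}
    (hd : HasDerivAt x d t) :
    ∃ s : ι → ℝ, (∀ i, s i ∈ multiSgn (inner ℝ (c i) (x t))) ∧ d = signedField F α c t (x t) s := by
  set lo : ι → ℝ := fun i => if 0 < inner ℝ (c i) (x t) then 1 else -1 with hlo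
  set hi : ι → ℝ := fun i => if inner ℝ (c i) (x t) < 0 then -1 else 1 with hhi
  set Q := signedField F α c t (x t) '' Icc lo hi with hQ
  have hmemIcc : ∀ s : ι → ℝ, s ∈ Icc lo hi ↔ ∀ i, s i ∈ multiSgn (inner ℝ (c i) (x t)) := by
    intro s
    simp only [multiSgn_eq_Icc, mem_Icc, Pi.le_def, hlo, hhi, forall_and]
  have htI := Ioo_subset_Icc_self ht
  have hXlim : Tendsto (fun p : ℕ × ℝ => X p.1 p.2) (atTop ×ˢ 𝓝[Icc 0 T] t) (𝓝 (x t)) := by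
    have h1 : Tendsto (fun p : ℕ × ℝ => x p.2) (atTop ×ˢ 𝓝[Icc 0 T] t) (𝓝 (x t)) :=
      hd.continuousAt.continuousWithinAt.tendsto.comp tendsto_snd
    refine h1.congr_uniformity ((tendstoUniformlyOn_iff_tendsto.1 hlim).mono_left ?_)
    exact Filter.prod_mono le_rfl inf_le_right
  have hFlim : Tendsto (fun p : ℕ × ℝ => F p.2 (X p.1 p.2)) (atTop ×ˢ 𝓝[Icc 0 T] t)
      (𝓝 (F t (x t))) := by
    have hcont := continuousOn_uncurry_of_norm_sub_le hL hF hc (t, x t) ⟨htI, mem_univ _⟩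
    refine hcont.tendsto.comp (tendsto_nhdsWithin_iff.2
      ⟨(tendsto_nhds_of_tendsto_nhdsWithin tendsto_snd).prodMk_nhds hXlim, ?_⟩)
    filter_upwards [tendsto_snd.eventually (self_mem_nhdsWithin (s := Icc 0 T) (a := t))] with p hp
    exact ⟨hp, mem_univ _⟩
  -- The limit is joint in the index and the time, so one threshold for the index serves a whole
  -- interval around `t`.
  have hev : ∀ δ > 0, ∀ᶠ p : ℕ × ℝ in atTop ×ˢ 𝓝[Icc 0 T] t,
      clampField F α c (e p.1) p.2 (X p.1 p.2) ∈ Metric.cthickening δ Q := by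
    intro δ hδ
    have hsgn : ∀ᶠ p : ℕ × ℝ in atTop ×ˢ 𝓝[Icc 0 T] t, ∀ i,
        clampSign (e p.1) (inner ℝ (c i) (X p.1 p.2)) ∈ multiSgn (inner ℝ (c i) (x t)) :=
      eventually_all.2 fun i => eventually_clampSign_mem_multiSgn (he.comp tendsto_fst)
        (fun p => hpos p.1) (tendsto_const_nhds.inner hXlim)
    filter_upwards [hsgn, Metric.tendsto_nhds.1 hFlim δ hδ] with p hp hpF
    refine Metric.mem_cthickening_of_dist_le _ _ δ Q ⟨_, (hmemIcc _).2 hp, rfl⟩ ?_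
    rw [clampField, signedField, signedField, dist_sub_right]
    exact hpF.le
  have hdmem : ∀ δ > 0, d ∈ Metric.cthickening δ Q := by
    intro δ hδ
    have hcl : IsClosed (Metric.cthickening δ Q) := Metric.isClosed_cthickening
    have hcv : Convex ℝ (Metric.cthickening δ Q) := (convex_image_signedField _ _ _ _).cthickening δ
    obtain ⟨pa, hpa, pb, hpb, hp⟩ := eventually_prod_iff.1 (hev δ hδ)
    have hnhds : ∀ᶠ r in 𝓝[≥] t, pb r ∧ r ∈ Icc 0 T := by
      have hI : Icc 0 T ∈ 𝓝 t := Icc_mem_nhds ht.1 ht.2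
      rw [nhdsWithin_eq_nhds.2 hI] at hpb
      exact (hpb.and hI).filter_mono nhdsWithin_le_nhds
    obtain ⟨u, hu, hsub⟩ := mem_nhdsGE_iff_exists_Icc_subset.1 hnhds
    have hslope := (hasDerivWithinAt_iff_tendsto_slope' (self_notMem_Ioi)).1
      (hd.hasDerivWithinAt (s := Ioi t))
    -- Two successive limits: for fixed `b` the quotient of `x` is the limit over `k` of the
    -- quotients of `X k`; then `b` decreases to `t`.
    refine hcl.mem_of_tendsto hslope ?_
    filter_upwards [Ioc_mem_nhdsGT hu] with b hb
    have hsub' : Icc t b ⊆ Icc 0 T := fun r hr => (hsub ⟨hr.1, hr.2.trans hb.2⟩).2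
    have hpt : ∀ r ∈ Icc 0 T, Tendsto (fun k => X k r) atTop (𝓝 (x r)) :=
      fun r hr => hlim.tendsto_at hr
    have hb' : b ∈ Icc t b := right_mem_Icc.2 hb.1.le
    refine hcl.mem_of_tendsto (((hpt b (hsub' hb')).sub (hpt t htI)).const_smul (b - t)⁻¹) ?_
    filter_upwards [hpa] with k hk
    refine hcv.inv_smul_sub_mem_of_hasDerivWithinAt hcl hb.1
      (fun r hr => (hX k r (hsub' hr)).mono hsub') ?_
      (fun r hr => hp hk (hsub ⟨hr.1, hr.2.trans hb.2⟩).1)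
    have hXc : ContinuousOn (X k) (Icc t b) :=
      fun r hr => ((hX k r (hsub' hr)).mono hsub').continuousWithinAt
    have hK : 0 ≤ L + (∑ i, α i * ‖c i‖) * ((∑ i, ‖c i‖) / e k) := by
      have := hpos k
      have : 0 ≤ ∑ i, α i * ‖c i‖ :=
        Finset.sum_nonneg fun i _ => mul_nonneg (hα i) (norm_nonneg _)
      positivity
    exact (continuousOn_uncurry_of_norm_sub_le hK
      (fun t ht => norm_clampField_sub_le (α := α) (c := c) hα hF (hpos k) ht)
      (continuousOn_clampField hc (e k))).comp (continuousOn_id.prodMk hXc)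
      fun r hr => ⟨hsub' hr, mem_univ _⟩
  have hdQ : d ∈ Q := by
    have hQcl : IsClosed Q := (isCompact_image_signedField t (x t) lo hi).isClosed
    rw [← hQcl.closure_eq, Metric.closure_eq_iInter_cthickening]
    simpa using hdmem
  obtain ⟨s, hs, hsd⟩ := hdQ
  exact ⟨s, (hmemIcc s).1 hs, hsd.symm⟩

/-- Existence of a Lipschitz solution of `ẋ ∈ F(t, x) - ∑ i, α i • sgn ⟨c i, x⟩ • c i`. -/
theorem exists_lipschitz_solution_signedField [FiniteDimensional ℝ E] (hT : 0 < T)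
    (hα : ∀ i, 0 ≤ α i) (hL : 0 ≤ L)
    (hF : ∀ t ∈ Icc 0 T, ∀ x₁ x₂ : E, ‖F t x₁ - F t x₂‖ ≤ L * ‖x₁ - x₂‖)
    (hc : ∀ x, ContinuousOn (fun t => F t x) (Icc 0 T)) (x₀ : E) :
    ∃ x : ℝ → E, (∃ K : NNReal, LipschitzOnWith K x (Icc 0 T)) ∧ x 0 = x₀ ∧
      ∀ᵐ t ∂(volume.restrict (Ioo 0 T)), ∃ s : ι → ℝ,
        (∀ i, s i ∈ multiSgn (inner ℝ (c i) (x t))) ∧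
          HasDerivAt x (signedField F α c t (x t) s) t := by
  have : CompleteSpace E := FiniteDimensional.complete ℝ E
  obtain ⟨S, hS⟩ := exists_solution_clampField (c := c) hT.le hα hL hF hc x₀
  set e : ℕ → ℝ := fun k => 1 / ((k : ℝ) + 1) with he
  have hpos : ∀ k, 0 < e k := fun k => by positivity
  have helim : Tendsto e atTop (𝓝 0) := tendsto_one_div_add_atTop_nhds_zero_nat
  choose X hX0 hX hXlip using fun k => hS (e k) (hpos k)
  have hAC : ∀ k, AbsolutelyContinuousOnInterval (X k) 0 T := fun k =>
    LipschitzOnWith.absolutelyContinuousOnInterval (by rw [uIcc_of_le hT.le]; exact hXlip k)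
  have happrox : ∀ k, ∀ᵐ t ∂(volume.restrict (Ioo 0 T)), ∃ s : ι → ℝ,
      (∀ i, IsApproxSign (e k) (inner ℝ (c i) (X k t)) (s i)) ∧
        HasDerivAt (X k) (signedField F α c t (X k t) s) t := by
    intro k
    filter_upwards [self_mem_ae_restrict measurableSet_Ioo] with t ht
    exact ⟨_, fun i => isApproxSign_clampSign (hpos k) _,
      (hX k t (Ioo_subset_Icc_self ht)).hasDerivAt (Icc_mem_nhds ht.1 ht.2)⟩
  set M := (∑ i, α i) * 4 * T * Real.exp (2 * L * T) with hM
  have hα0 : 0 ≤ ∑ i, α i := Finset.sum_nonneg fun i _ => hα i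
  have hM0 : 0 ≤ M := by positivity
  have hdist : ∀ k l, ∀ t ∈ Icc 0 T, ‖X k t - X l t‖ ^ 2 ≤ M * (e k + e l) := by
    intro k l t ht
    refine (norm_sub_sq_le_of_isApproxSign hα hL (hpos k).le (hpos l).le hF (hAC k) (hAC l)
      (by rw [hX0, hX0]) (happrox k) (happrox l) ht).trans ?_
    have h1 := ht.1
    have h2 := ht.2
    have := hpos k
    have := hpos l
    calc (∑ i, α i) * (4 * (e k + e l)) * t * Real.exp (2 * L * t)
        ≤ (∑ i, α i) * (4 * (e k + e l)) * T * Real.exp (2 * L * T) := by gcongr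
      _ = M * (e k + e l) := by rw [hM]; ring
  have hCauchy : UniformCauchySeqOn X atTop (Icc 0 T) := by
    rw [Metric.uniformCauchySeqOn_iff]
    intro η hη
    have hlim : Tendsto (fun k => M * (e k + e k)) atTop (𝓝 0) := by
      simpa using (helim.add helim).const_mul M
    obtain ⟨N, hN⟩ := (hlim.eventually_lt_const (show (0 : ℝ) < η ^ 2 by positivity)).exists
    refine ⟨N, fun k hk l hl t ht => ?_⟩
    have hanti : ∀ k ≥ N, e k ≤ e N := fun k hk => by
      simp only [he]; gcongr
    rw [dist_eq_norm]
    refine lt_of_pow_lt_pow_left₀ 2 hη.le ((hdist k l t ht).trans_lt (lt_of_le_of_lt ?_ hN))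
    have := hanti k hk
    have := hanti l hl
    gcongr
  have hpt : ∀ t, ∃ y, t ∈ Icc 0 T → Tendsto (fun k => X k t) atTop (𝓝 y) := by
    intro t
    by_cases ht : t ∈ Icc 0 T
    · obtain ⟨y, hy⟩ := cauchySeq_tendsto_of_complete (hCauchy.cauchySeq ht)
      exact ⟨y, fun _ => hy⟩
    · exact ⟨0, fun h => absurd h ht⟩
  choose x hx using hpt
  have hlim : TendstoUniformlyOn X x atTop (Icc 0 T) :=
    hCauchy.tendstoUniformlyOn_of_tendsto hx
  have hxlip : LipschitzOnWith S x (Icc 0 T) := LipschitzOnWith.of_dist_le_mul fun a ha b hb =>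
    le_of_tendsto' ((hx a ha).dist (hx b hb)) fun k => (hXlip k).dist_le_mul a ha b hb
  have h0 : (0 : ℝ) ∈ Icc 0 T := left_mem_Icc.2 hT.le
  refine ⟨x, ⟨S, hxlip⟩, tendsto_nhds_unique (hx 0 h0) (by simp [hX0]), ?_⟩
  filter_upwards [hxlip.ae_differentiableWithinAt_real measurableSet_Icc |>.filter_mono
    (ae_mono (Measure.restrict_mono Ioo_subset_Icc_self le_rfl)),
    self_mem_ae_restrict measurableSet_Ioo] with t htd ht
  have hd := (htd.differentiableAt (Icc_mem_nhds ht.1 ht.2)).hasDerivAt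
  obtain ⟨s, hs, hds⟩ := exists_sign_of_tendstoUniformlyOn hα hL hF hc helim hpos hX hlim ht hd
  exact ⟨s, hs, hds ▸ hd⟩

end Existence

/-! ### A version of the field continuous in time -/

section Regularity

variable {E : Type*} [NormedAddCommGroup E]

theorem ContinuousOn.le_of_ae_le_Ioo {h : ℝ → ℝ} {a b C : ℝ} (hab : a < b)
    (hc : ContinuousOn h (Icc a b)) (hae : ∀ᵐ t ∂(volume.restrict (Ioo a b)), h t ≤ C) :
    ∀ t ∈ Icc a b, h t ≤ C := by
  have heq : (fun t => max (h t) C) =ᵐ[volume.restrict (Icc a b)] fun _ => C := by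
    rw [← Measure.restrict_congr_set (Ioo_ae_eq_Icc (μ := volume) (a := a) (b := b))]
    filter_upwards [hae] with t ht using max_eq_right ht
  intro t ht
  have := Measure.eqOn_Icc_of_ae_eq volume hab.ne heq (hc.sup continuousOn_const)
    continuousOn_const ht
  exact max_eq_right_iff.1 this

/-- A Lipschitz family that has a time derivative coincides, for almost all times, with a family
that is Lipschitz in the state and continuous in time. -/
theorem IsTimeDerivative.exists_continuous_version [NormedSpace ℝ E]
    [TopologicalSpace.SeparableSpace E] {T L : ℝ} {f g : ℝ → E → E} (hT : 0 < T)
    (hg : IsTimeDerivative T f g)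
    (hf : ∀ t ∈ Icc 0 T, ∀ x₁ x₂ : E, ‖f t x₁ - f t x₂‖ ≤ L * ‖x₁ - x₂‖) :
    ∃ F : ℝ → E → E, (∀ t ∈ Icc 0 T, ∀ x₁ x₂ : E, ‖F t x₁ - F t x₂‖ ≤ L * ‖x₁ - x₂‖) ∧
      (∀ x, ContinuousOn (fun t => F t x) (Icc 0 T)) ∧
      ∀ᵐ t ∂(volume.restrict (Ioo 0 T)), ∀ x, f t x = F t x := by
  choose hint c hc using hg
  set F : ℝ → E → E := fun t x => c x + ∫ r in (0 : ℝ)..t, g r x with hFdef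
  have hcont : ∀ x, ContinuousOn (fun t => F t x) (Icc 0 T) := by
    intro x
    have hi : IntegrableOn (fun t => g t x) (uIcc 0 T) := by
      rw [uIcc_of_le hT.le, integrableOn_Icc_iff_integrableOn_Ioo]
      exact hint x
    have := intervalIntegral.continuousOn_primitive_interval hi
    rw [uIcc_of_le hT.le] at this
    exact continuousOn_const.add this
  have hF : ∀ t ∈ Icc 0 T, ∀ x₁ x₂ : E, ‖F t x₁ - F t x₂‖ ≤ L * ‖x₁ - x₂‖ := by
    intro t ht x₁ x₂
    -- For each pair of states the bound passes from `f` to `F` off a null set depending on the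
    -- pair; continuity in time removes that set.
    refine ContinuousOn.le_of_ae_le_Ioo (h := fun t => ‖F t x₁ - F t x₂‖) hT
      ((hcont x₁).sub (hcont x₂)).norm ?_ t ht
    filter_upwards [hc x₁, hc x₂, self_mem_ae_restrict measurableSet_Ioo] with s h₁ h₂ hs
    have := hf s (Ioo_subset_Icc_self hs) x₁ x₂
    rwa [h₁, h₂] at this
  refine ⟨F, hF, hcont, ?_⟩
  -- A countable dense set of states yields one null set of times; continuity in the state extends
  -- the equality to all states.
  obtain ⟨D, hDc, hDd⟩ := TopologicalSpace.exists_countable_dense E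
  filter_upwards [(ae_ball_iff hDc).2 fun x _ => hc x, self_mem_ae_restrict measurableSet_Ioo]
    with t hD ht
  have ht := Ioo_subset_Icc_self ht
  have hlip : ∀ {G : ℝ → E → E}, (∀ t ∈ Icc 0 T, ∀ x₁ x₂ : E, ‖G t x₁ - G t x₂‖ ≤ L * ‖x₁ - x₂‖) →
      Continuous (G t) := fun {G} hG =>
    (LipschitzWith.of_dist_le_mul (K := L.toNNReal) fun x y => by
      rw [dist_eq_norm, dist_eq_norm]
      exact (hG t ht x y).trans
        (mul_le_mul_of_nonneg_right (Real.le_coe_toNNReal L) (norm_nonneg _))).continuous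
  exact congrFun (Continuous.ext_on hDd (hlip hf) (hlip hF) fun x hx => hD x hx)

end Regularity

/-! ### Rank-one structure from the kernel condition -/

section Matrices

variable {n : ℕ}

theorem matAct_sub_smul {p q : ℕ} (M : Matrix (Fin p) (Fin q) ℝ)
    (x y : EuclideanSpace ℝ (Fin q)) (r : ℝ) :
    matAct M (x - r • y) = matAct M x - r • matAct M y := by
  simp [matAct, Matrix.mulVec_sub, Matrix.mulVec_smul]

theorem matAct_row_apply (C : Matrix (Fin 1) (Fin n) ℝ) (x : EuclideanSpace ℝ (Fin n)) :
    matAct C x 0 = inner ℝ (colVec C.transpose) x := by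
  simp [matAct, colVec, Matrix.mulVec, dotProduct, PiLp.inner_apply, mul_comm]

theorem mem_matKer_row_iff (C : Matrix (Fin 1) (Fin n) ℝ) (x : EuclideanSpace ℝ (Fin n)) :
    x ∈ matKer C ↔ inner ℝ (colVec C.transpose) x = (0 : ℝ) := by
  rw [← matAct_row_apply]
  constructor
  · intro h
    have h : matAct C x = 0 := h
    rw [h]; rfl
  · intro h
    change matAct C x = 0
    ext i
    rw [Subsingleton.elim i 0, h]; rfl

/-- A matrix that vanishes on the kernel of a row has rank at most one. -/
theorem exists_matAct_eq_inner_smul (A : Matrix (Fin n) (Fin n) ℝ) (C : Matrix (Fin 1) (Fin n) ℝ)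
    (hker : matKer C ⊆ matKer A) :
    ∃ a : EuclideanSpace ℝ (Fin n), ∀ x, matAct A x = (inner ℝ (colVec C.transpose) x : ℝ) • a := by
  set c := colVec C.transpose with hc
  -- Subtracting from `x` its projection on `c` leaves an element of the kernel. If `c = 0`, the
  -- inverse takes its default value 0 and `x` itself is in the kernel.
  refine ⟨(inner ℝ c c : ℝ)⁻¹ • matAct A c, fun x => ?_⟩
  have hmem : x - ((inner ℝ c x : ℝ) * (inner ℝ c c : ℝ)⁻¹) • c ∈ matKer C := by
    rw [mem_matKer_row_iff, ← hc, inner_sub_right, inner_smul_right]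
    by_cases h : c = 0
    · simp [h]
    · have : (inner ℝ c c : ℝ) ≠ 0 := inner_self_ne_zero.2 h
      field_simp
      ring
  have h0 : matAct A _ = 0 := hker hmem
  rw [matAct_sub_smul, sub_eq_zero] at h0
  rw [h0, smul_smul]

/-- At `u = 0` the factor `u` cancels the ambiguity of the sign, so the product is single-valued. -/
theorem mul_eq_abs_of_mem_multiSgn {u s : ℝ} (h : s ∈ multiSgn u) : s * u = |u| := by
  obtain ⟨h1, h2, -⟩ := h
  rcases lt_trichotomy u 0 with hu | hu | hu
  · rw [h1 hu, abs_of_neg hu]; ring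
  · simp [hu]
  · rw [h2 hu, abs_of_pos hu]; ring

theorem sub_sum_eq_signedField {m : ℕ}
    {f F : ℝ → EuclideanSpace ℝ (Fin n) → EuclideanSpace ℝ (Fin n)}
    {A : Fin m → Matrix (Fin n) (Fin n) ℝ} {B : Fin m → Matrix (Fin n) (Fin 1) ℝ}
    {c a : Fin m → EuclideanSpace ℝ (Fin n)} {α : Fin m → ℝ}
    (hA : ∀ i x, matAct (A i) x = (inner ℝ (c i) x : ℝ) • a i)
    (hB : ∀ i, colVec (B i) = α i • c i) {t : ℝ} {x : EuclideanSpace ℝ (Fin n)}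
    (hfF : f t x = F t x) {s : Fin m → ℝ} (hs : ∀ i, s i ∈ multiSgn (inner ℝ (c i) x)) :
    f t x - ∑ i, s i • (matAct (A i) x + colVec (B i)) =
      signedField (fun t x => F t x - ∑ i, |(inner ℝ (c i) x : ℝ)| • a i) α c t x s := by
  rw [signedField, hfF, sub_sub, ← Finset.sum_add_distrib]
  congr 1
  refine Finset.sum_congr rfl fun i _ => ?_
  rw [hA, hB, smul_add, smul_smul, smul_smul, mul_eq_abs_of_mem_multiSgn (hs i), mul_comm (s i)]

theorem norm_sum_abs_inner_smul_sub_le {E ι : Type*} [NormedAddCommGroup E] [InnerProductSpace ℝ E]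
    [Fintype ι] (c a : ι → E) (x y : E) :
    ‖∑ i, |(inner ℝ (c i) x : ℝ)| • a i - ∑ i, |(inner ℝ (c i) y : ℝ)| • a i‖
      ≤ (∑ i, ‖c i‖ * ‖a i‖) * ‖x - y‖ := by
  rw [← Finset.sum_sub_distrib, Finset.sum_mul]
  refine norm_sum_le_of_le _ fun i _ => ?_
  rw [← sub_smul, norm_smul, Real.norm_eq_abs]
  have h : |(|(inner ℝ (c i) x : ℝ)| - |(inner ℝ (c i) y : ℝ)|)| ≤ ‖c i‖ * ‖x - y‖ := by
    refine (abs_abs_sub_abs_le_abs_sub _ _).trans ?_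
    rw [← inner_sub_right]
    exact abs_real_inner_le_norm _ _
  calc _ ≤ ‖c i‖ * ‖x - y‖ * ‖a i‖ := by gcongr
    _ = _ := by ring

end Matrices

/-! ### Well-posedness of the inclusion -/

theorem mainTheorem9 {n m : ℕ} (T : ℝ) (hT : 0 < T)
    (f : ℝ → EuclideanSpace ℝ (Fin n) → EuclideanSpace ℝ (Fin n))
    (hf_lip : UniformlyLipschitzInState T f)
    (hf_time : TimeDerivativeL2Bounded T f)
    (A : Fin m → Matrix (Fin n) (Fin n) ℝ) (B : Fin m → Matrix (Fin n) (Fin 1) ℝ)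
    (C : Fin m → Matrix (Fin 1) (Fin n) ℝ) (D : Fin m → ℝ)
    (hB : ∀ i, ∃ α : ℝ, 0 < α ∧ B i = α • (C i).transpose)
    (hD : ∀ i, D i = 0)
    (hker : ∀ i, matKer (C i) ⊆ matKer (A i))
    (x₀ : EuclideanSpace ℝ (Fin n)) :
    ∃ x : ℝ → EuclideanSpace ℝ (Fin n),
      (∃ K : NNReal, LipschitzOnWith K x (Set.Icc 0 T)) ∧
      IsSolution T (inclusionRHS f A B C D) x₀ x ∧
      ∀ y : ℝ → EuclideanSpace ℝ (Fin n),
        IsSolution T (inclusionRHS f A B C D) x₀ y → Set.EqOn y x (Set.Icc 0 T) := by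
  obtain ⟨L, hL, hf⟩ := hf_lip
  obtain ⟨g, hg, -⟩ := hf_time
  obtain ⟨F, hF, hFc, hfF⟩ := hg.exists_continuous_version hT hf
  choose α hα hBα using hB
  choose a hA using fun i => exists_matAct_eq_inner_smul (A i) (C i) (hker i)
  set c : Fin m → EuclideanSpace ℝ (Fin n) := fun i => colVec (C i).transpose with hc
  have hBc : ∀ i, colVec (B i) = α i • c i := by
    intro i
    ext j
    simp [hBα i, hc, colVec]
  have hα0 : ∀ i, 0 ≤ α i := fun i => (hα i).le
  have hCD : ∀ i x, matAct (C i) x 0 + D i = inner ℝ (c i) x := fun i x => by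
    rw [hD, add_zero, matAct_row_apply]
  set G : ℝ → EuclideanSpace ℝ (Fin n) → EuclideanSpace ℝ (Fin n) :=
    fun t x => F t x - ∑ i, |(inner ℝ (c i) x : ℝ)| • a i with hGdef
  set L' := L + ∑ i, ‖c i‖ * ‖a i‖ with hL'def
  have hL' : 0 ≤ L' := by positivity
  have hG : ∀ t ∈ Icc 0 T, ∀ x₁ x₂, ‖G t x₁ - G t x₂‖ ≤ L' * ‖x₁ - x₂‖ := by
    intro t ht x₁ x₂
    rw [hGdef, hL'def, add_mul]
    simp only
    rw [sub_sub_sub_comm]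
    exact (norm_sub_le _ _).trans
      (add_le_add (hF t ht x₁ x₂) (norm_sum_abs_inner_smul_sub_le c a x₁ x₂))
  have hGc : ∀ x, ContinuousOn (fun t => G t x) (Icc 0 T) := fun x =>
    (hFc x).sub continuousOn_const
  obtain ⟨x, ⟨K, hxK⟩, hx0, hx⟩ :=
    exists_lipschitz_solution_signedField (c := c) hT hα0 hL' hG hGc x₀
  have hxac : AbsolutelyContinuousOnInterval x 0 T :=
    LipschitzOnWith.absolutelyContinuousOnInterval (by rwa [uIcc_of_le hT.le])
  refine ⟨x, ⟨K, hxK⟩, ⟨hxac, hx0, ?_⟩, fun y hy t ht => ?_⟩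
  · filter_upwards [hx, hfF] with t ⟨s, hs, hxs⟩ hft
    refine ⟨_, ⟨s, fun i => by rw [hCD]; exact hs i, ?_⟩, hxs⟩
    exact (sub_sum_eq_signedField hA hBc (hft _) hs).symm
  · have hy' : ∀ᵐ t ∂(volume.restrict (Ioo 0 T)), ∃ s : Fin m → ℝ,
        (∀ i, IsApproxSign 0 (inner ℝ (c i) (y t)) (s i)) ∧
          HasDerivAt y (signedField G α c t (y t) s) t := by
      filter_upwards [hy.inclusion, hfF] with t ⟨y', ⟨s, hs, hys⟩, hyd⟩ hft
      simp only [hCD] at hs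
      refine ⟨s, fun i => isApproxSign_of_mem_multiSgn (hs i), ?_⟩
      rw [← sub_sum_eq_signedField hA hBc (hft _) hs, ← hys]
      exact hyd
    have hx' : ∀ᵐ t ∂(volume.restrict (Ioo 0 T)), ∃ s : Fin m → ℝ,
        (∀ i, IsApproxSign 0 (inner ℝ (c i) (x t)) (s i)) ∧
          HasDerivAt x (signedField G α c t (x t) s) t := by
      filter_upwards [hx] with t ⟨s, hs, hxs⟩
      exact ⟨s, fun i => isApproxSign_of_mem_multiSgn (hs i), hxs⟩
    -- Both functions carry exact signs, so the error terms are 0 and the bound vanishes.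
    have h := norm_sub_sq_le_of_isApproxSign hα0 hL' le_rfl le_rfl hG hy.absCont hxac
      (by rw [hy.initial, hx0]) hy' hx' ht
    have h0 : ‖y t - x t‖ ^ 2 ≤ 0 := by simpa using h
    exact sub_eq_zero.1 (norm_eq_zero.1 (pow_eq_zero_iff two_ne_zero |>.1
      (le_antisymm h0 (sq_nonneg _))))
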